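/- For $q>1$, the (Poissonized) base-$q$ LogLog sketch $q$-LL has state space $\mathbb Z$, and at cardinality $\lambda>0$ it is in state $k$ with probability $$\psi_{q,\lambda}(k)=e^{-\lambda/q^{k}}-e^{-\lambda/q^{k-1}}.$$ Write $H_q(\lambda)=-\sum_{k\in\mathbb Z}\psi_{q,\lambda}(k)\log_2\psi_{q,\lambda}(k)$ for its Shannon entropy and $I_q(\lambda)=\sum_{k\in\mathbb Z}\psi_{q,\lambda}(k)\left(\frac{\partial_\lambda\psi_{q,\lambda}(k)}{\psi_{q,\lambda}(k)}\right)^2$ for its Fisher information with respect to $\lambda$. The Fish number of $q$-LL is $$\mathsf{Fish}(q\text{-LL})=\frac{\int_0^1 H_q(q^{r})\,dr}{\int_0^1 q^{2r}I_q(q^{r})\,dr}.$$ Let $h(x)=-x\ln x-(1-x)\ln(1-x)$, $g(x)=\frac{x^2}{e^x-1}$, and $$H_0=\frac1{\ln 2}\int_{-\infty}^{\infty}h\!\left(e^{-e^{w}}\right)dw,\qquad I_0=\int_{-\infty}^{\infty}g\!\left(e^{w}\right)dw,$$ $$\phi(q)=\int_{-\infty}^{\infty}-\left(e^{-e^r}-e^{-e^rq}\right)\log_2\left(e^{-e^r}-e^{-e^rq}\right)dr,\qquad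 \rho(q)=\int_{-\infty}^{\infty}\frac{\left(-e^re^{-e^r}+e^rq\,e^{-e^rq}\right)^2}{e^{-e^r}-e^{-e^rq}}\,dr.$$ **Theorem.** The integrals defining $H_0$ and $I_0$ converge absolutely and $I_0>0$. For every real $q>1$, $\psi_{q,\lambda}$ is a probability distribution on $\mathbb Z$ for each $\lambda>0$; the sketch $q$-LL is weakly scale-invariant with base $q$, i.e. $H_q(\lambda)=H_q(q\lambda)$ and $I_q(\lambda)=q^2I_q(q\lambda)$ for all $\lambda>0$; all sums and integrals above converge absolutely, with $\int_0^1q^{2r}I_q(q^r)\,dr>0$ and $\rho(q)>0$; and $$\mathsf{Fish}(q\text{-LL})=\frac{\phi(q)}{\rho(q)}>\frac{H_0}{I_0}.$$ Furthermore, $$\lim_{q\to\infty}\mathsf{Fish}(q\text{-LL})=\frac{H_0}{I_0}.$$ -/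

import Mathlib

open Filter Topology MeasureTheory

noncomputable section

namespace Sketch

/-- `ψ t x` is the probability that a sketch with state space `M` is in state `x` at cardinality
`t`. The family `ψ` is an induced distribution family when every `ψ t` with `t > 0` is a
probability mass function on the countable type `M`. -/
structure IsInducedFamily {M : Type*} [Countable M] (ψ : ℝ → M → ℝ) : Prop where
  nonneg : ∀ t : ℝ, 0 < t → ∀ x, 0 ≤ ψ t x
  hasSum_one : ∀ t : ℝ, 0 < t → HasSum (ψ t) 1

/-- The summand `p(x) · (-log₂ p(x))` of the Shannon entropy of a mass function `p`. -/
def entropyTerm {M : Type*} (p : M → ℝ) (x : M) : ℝ :=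
  p x * (-Real.logb 2 (p x))

/-- Shannon entropy in bits, `E(-log₂ p(X))` for `X ∼ p`. -/
def entropy {M : Type*} (p : M → ℝ) : ℝ :=
  ∑' x, entropyTerm p x

/-- The summand `ψ_t(x) · ((∂/∂t ψ_t(x)) / ψ_t(x))²` of the Fisher information. -/
def fisherTerm {M : Type*} (ψ : ℝ → M → ℝ) (t : ℝ) (x : M) : ℝ :=
  ψ t x * (deriv (fun s => ψ s x) t / ψ t x) ^ 2

/-- Fisher information of the parameter (the cardinality) at `t`,
`E(((∂/∂t ψ_t(X)) / ψ_t(X))²)` for `X ∼ ψ_t`. -/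
def fisherInfo {M : Type*} (ψ : ℝ → M → ℝ) (t : ℝ) : ℝ :=
  ∑' x, fisherTerm ψ t x

/-- Weak scale-invariance with base `q`. -/
def WeaklyScaleInvariant {M : Type*} (ψ : ℝ → M → ℝ) (q : ℝ) : Prop :=
  ∀ t : ℝ, 0 < t →
    entropy (ψ t) = entropy (ψ (q * t)) ∧
    fisherInfo ψ t = q ^ 2 * fisherInfo ψ (q * t)

/-- Average entropy `∫₀¹ H(X_{q^r}) dr`. -/
def avgEntropy {M : Type*} (ψ : ℝ → M → ℝ) (q : ℝ) : ℝ :=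
  ∫ r in (0 : ℝ)..1, entropy (ψ (q ^ r))

/-- Average normalized Fisher information `∫₀¹ q^{2r} I(q^r) dr`. -/
def avgInfo {M : Type*} (ψ : ℝ → M → ℝ) (q : ℝ) : ℝ :=
  ∫ r in (0 : ℝ)..1, q ^ (2 * r) * fisherInfo ψ (q ^ r)

/-- The Fisher–Shannon number of a sketch that is weakly scale-invariant with base `q`. -/
def fish {M : Type*} (ψ : ℝ → M → ℝ) (q : ℝ) : ℝ :=
  avgEntropy ψ q / avgInfo ψ q

/-- The base-`q` LogLog sketch (Poissonized, state space `ℤ`):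
state `k` has probability `e^{-t/q^k} - e^{-t/q^{k-1}}` at cardinality `t`. -/
def qLL (q : ℝ) (t : ℝ) (k : ℤ) : ℝ :=
  Real.exp (-(t / q ^ k)) - Real.exp (-(t / q ^ (k - 1)))

/-- `h(x) = -x ln x - (1-x) ln (1-x)`. -/
def h (x : ℝ) : ℝ :=
  -x * Real.log x - (1 - x) * Real.log (1 - x)

/-- `g(x) = x² / (e^x - 1)`. -/
def g (x : ℝ) : ℝ :=
  x ^ 2 / (Real.exp x - 1)

def H₀ : ℝ :=
  1 / Real.log 2 * ∫ w : ℝ, h (Real.exp (-Real.exp w))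

def I₀ : ℝ :=
  ∫ w : ℝ, g (Real.exp w)

/-- The integrand of `φ(q)`. -/
def phiIntegrand (q r : ℝ) : ℝ :=
  -(Real.exp (-Real.exp r) - Real.exp (-(Real.exp r * q))) *
    Real.logb 2 (Real.exp (-Real.exp r) - Real.exp (-(Real.exp r * q)))

/-- The integrand of `ρ(q)`. -/
def rhoIntegrand (q r : ℝ) : ℝ :=
  (-(Real.exp r * Real.exp (-Real.exp r)) +
      Real.exp r * q * Real.exp (-(Real.exp r * q))) ^ 2 /
    (Real.exp (-Real.exp r) - Real.exp (-(Real.exp r * q)))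

def phi (q : ℝ) : ℝ := ∫ r : ℝ, phiIntegrand q r

def rho (q : ℝ) : ℝ := ∫ r : ℝ, rhoIntegrand q r

end Sketch

end

/-! ### Exponentially decaying functions and their periodizations. -/

namespace Sketch

/-! In the log scale, the entropy and normalized Fisher terms of state `k` at `q ^ r` are the
integrands of φ and ρ sampled at `(r - k) log q`. Averaging over a period turns the sums over `ℤ`
into integrals over the line (`ExpDecay.integral_tsum_shift`); the common factor `1 / log q`
cancels, so Fish is φ/ρ. State `k` means that column `k` is hit and all columns above it are empty:
`e^{-x} - e^{-xq} = e^{-x} (1 - e^{-x(q-1)})`. This factorization yields chain rules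
(`phiIntegrand_eq`, `rhoIntegrand_eq`): each integrand is a translate of `W h` (up to `1 / ln 2`) or
`W g`, with weight `W(w) = exp(-e^w / (q-1))`, plus a difference `K(r) - K(r + log q)` of integral
zero. So φ and ρ are the integrals of `H₀` and `I₀` weighted by `W`. The weight is strictly
decreasing, and so is `h(e^{-x}) / g(x)` (`strictAntiOn_h_exp_neg_div_g`); a Chebyshev-type
comparison (`integral_div_lt_of_strictAnti`) gives the strict inequality. As `q → ∞`, `W → 1` and
dominated convergence gives the limit. -/

theorem integrable_exp_neg_half_abs : Integrable (fun s : ℝ => Real.exp (-|s| / 2)) := by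
  rw [← integrableOn_univ, ← Set.Iic_union_Ioi (a := (0 : ℝ))]
  refine IntegrableOn.union ?_ ?_
  · refine (integrableOn_exp_mul_Iic (a := 1 / 2) (by norm_num) 0).congr_fun ?_ measurableSet_Iic
    intro s hs
    simp only [abs_of_nonpos (Set.mem_Iic.1 hs)]
    ring_nf
  · refine (integrableOn_exp_mul_Ioi (a := -1 / 2) (by norm_num) 0).congr_fun ?_ measurableSet_Ioi
    intro s hs
    simp only [abs_of_pos (Set.mem_Ioi.1 hs)]
    ring_nf

theorem summable_exp_neg_mul_abs_int {b : ℝ} (hb : 0 < b) :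
    Summable (fun k : ℤ => Real.exp (-(b * |(k : ℝ)|))) := by
  have hnat : Summable (fun n : ℕ => Real.exp (-(b * (n : ℝ)))) := by
    have := Real.summable_exp_nat_mul_iff.2 (neg_lt_zero.2 hb)
    refine this.congr fun n => ?_
    ring_nf
  refine Summable.of_nat_of_neg ?_ ?_ <;> simpa using hnat

/-- Continuous functions on the line that decay like `e^{-|s|/2}`. -/
structure ExpDecay (G : ℝ → ℝ) : Prop where
  continuous : Continuous G
  bound : ∃ C : ℝ, ∀ s, |G s| ≤ C * Real.exp (-|s| / 2)

namespace ExpDecay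

variable {G K : ℝ → ℝ}

theorem integrable (hG : ExpDecay G) : Integrable G := by
  obtain ⟨C, hC⟩ := hG.bound
  exact (integrable_exp_neg_half_abs.const_mul C).mono' hG.continuous.aestronglyMeasurable
    (ae_of_all _ hC)

theorem add (hG : ExpDecay G) (hK : ExpDecay K) : ExpDecay (fun s => G s + K s) := by
  obtain ⟨C, hC⟩ := hG.bound
  obtain ⟨D, hD⟩ := hK.bound
  refine ⟨hG.continuous.add hK.continuous, C + D, fun s => ?_⟩
  rw [add_mul]
  exact (abs_add_le _ _).trans (add_le_add (hC s) (hD s))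

theorem mul_of_abs_le (hG : ExpDecay G) (hK : Continuous K) {B : ℝ} (hB : ∀ s, |K s| ≤ B) :
    ExpDecay (fun s => K s * G s) := by
  obtain ⟨C, hC⟩ := hG.bound
  refine ⟨hK.mul hG.continuous, B * C, fun s => ?_⟩
  rw [abs_mul, mul_assoc]
  exact mul_le_mul (hB s) (hC s) (abs_nonneg _) ((abs_nonneg _).trans (hB s))

theorem const_mul (hG : ExpDecay G) (c : ℝ) : ExpDecay (fun s => c * G s) :=
  hG.mul_of_abs_le continuous_const (fun _ => le_refl |c|)

theorem sub (hG : ExpDecay G) (hK : ExpDecay K) : ExpDecay (fun s => G s - K s) := by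
  simpa [sub_eq_add_neg] using hG.add (hK.const_mul (-1))

theorem comp_add_right (hG : ExpDecay G) (a : ℝ) : ExpDecay (fun s => G (s + a)) := by
  obtain ⟨C, hC⟩ := hG.bound
  have hC0 : 0 ≤ C := by
    have := (abs_nonneg _).trans (hC 0)
    simpa using this
  refine ⟨hG.continuous.comp (by fun_prop), C * Real.exp (|a| / 2), fun s => ?_⟩
  refine (hC _).trans ?_
  rw [mul_assoc, ← Real.exp_add]
  refine mul_le_mul_of_nonneg_left (Real.exp_le_exp.2 ?_) hC0
  have h1 : |s| ≤ |s + a| + |a| := by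
    simpa using abs_sub (s + a) a
  linarith

/-- With `x = e^s`, the majorant `e^{-|s|/2}` is `√x` for `x ≤ 1` and `1/√x` for `x ≥ 1`. -/
theorem of_exp_bound {F : ℝ → ℝ} (hc : Continuous fun s => F (Real.exp s)) {C : ℝ}
    (h0 : ∀ x, 0 < x → x ≤ 1 → |F x| ≤ C * √x) (h1 : ∀ x, 1 ≤ x → |F x| ≤ C * (√x)⁻¹) :
    ExpDecay (fun s => F (Real.exp s)) := by
  refine ⟨hc, C, fun s => ?_⟩
  rcases le_total s 0 with hs | hs
  · have := h0 _ (Real.exp_pos s) (Real.exp_le_one_iff.2 hs)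
    rwa [abs_of_nonpos hs, neg_neg, Real.exp_half]
  · have := h1 _ (Real.one_le_exp hs)
    rwa [abs_of_nonneg hs, neg_div, Real.exp_neg, Real.exp_half]

theorem of_exp_bound_linear {F : ℝ → ℝ} (hc : Continuous fun s => F (Real.exp s)) {C : ℝ}
    (hC : 0 ≤ C) (h0 : ∀ x, 0 < x → x ≤ 1 → |F x| ≤ C * x) (h1 : ∀ x, 1 ≤ x → |F x| ≤ C / x) :
    ExpDecay (fun s => F (Real.exp s)) := by
  refine of_exp_bound hc (C := C) (fun x hx hx1 => (h0 x hx hx1).trans ?_)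
    (fun x hx1 => (h1 x hx1).trans ?_)
  · exact mul_le_mul_of_nonneg_left (Real.le_sqrt_of_sq_le (by nlinarith)) hC
  · rw [div_eq_mul_inv]
    refine mul_le_mul_of_nonneg_left ?_ hC
    refine inv_anti₀ (Real.sqrt_pos.2 (by linarith)) ?_
    exact (Real.sqrt_le_self_iff.2 (Or.inr hx1))

/-- Since `|k| b ≤ |s| + |s - k b|`, the terms decay geometrically in `|k|`, uniformly for `|s| ≤
R`. This one majorant gives summability, continuity of the periodization and the exchange of sum and
integral. -/
theorem exists_summable_bound (hG : ExpDecay G) {b : ℝ} (hb : 0 < b) (R : ℝ) :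
    ∃ u : ℤ → ℝ, Summable u ∧ ∀ s, |s| ≤ R → ∀ k : ℤ, |G (s - k * b)| ≤ u k := by
  obtain ⟨C, hC⟩ := hG.bound
  have hC0 : 0 ≤ C := by
    have := (abs_nonneg _).trans (hC 0)
    simpa using this
  refine ⟨fun k => C * Real.exp (R / 2) * Real.exp (-(b / 2 * |(k : ℝ)|)),
    (summable_exp_neg_mul_abs_int (half_pos hb)).mul_left _, fun s hs k => (hC _).trans ?_⟩
  beta_reduce
  rw [mul_assoc, ← Real.exp_add]
  refine mul_le_mul_of_nonneg_left (Real.exp_le_exp.2 ?_) hC0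
  have h1 : |(k : ℝ) * b| ≤ |s| + |s - k * b| := by
    simpa using abs_sub s (s - k * b)
  rw [abs_mul, abs_of_pos hb] at h1
  linarith

theorem summable_shift (hG : ExpDecay G) {b : ℝ} (hb : 0 < b) (s : ℝ) :
    Summable (fun k : ℤ => G (s - k * b)) := by
  obtain ⟨u, hu, h⟩ := hG.exists_summable_bound hb |s|
  exact Summable.of_norm_bounded hu (h s le_rfl)

theorem continuousOn_tsum_shift (hG : ExpDecay G) {b : ℝ} (hb : 0 < b) :
    ContinuousOn (fun r : ℝ => ∑' k : ℤ, G (r * b - k * b)) (Set.Icc 0 1) := by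
  obtain ⟨u, hu, h⟩ := hG.exists_summable_bound hb b
  refine continuousOn_tsum (fun k => (hG.continuous.comp (by fun_prop)).continuousOn) hu ?_
  intro k r hr
  refine h _ ?_ k
  rw [abs_of_nonneg (mul_nonneg hr.1 hb.le)]
  nlinarith [hr.2]

/-- Averaging the `b`-periodization of `G` over a period gives the integral of `G`. -/
theorem integral_tsum_shift (hG : ExpDecay G) {b : ℝ} (hb : 0 < b) :
    ∫ r in (0 : ℝ)..1, ∑' k : ℤ, G (r * b - k * b) = (∫ s, G s) / b := by
  obtain ⟨u, hu, h⟩ := hG.exists_summable_bound hb b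
  have hswap : HasSum (fun k : ℤ => ∫ r in (0 : ℝ)..1, G (r * b - k * b))
      (∫ r in (0 : ℝ)..1, ∑' k : ℤ, G (r * b - k * b)) := by
    refine intervalIntegral.hasSum_integral_of_dominated_convergence (fun k _ => u k)
      (fun k => (hG.continuous.comp (by fun_prop)).aestronglyMeasurable) (fun k => ?_)
      (ae_of_all _ fun _ _ => hu) intervalIntegrable_const
      (ae_of_all _ fun r _ => (hG.summable_shift hb _).hasSum)
    refine ae_of_all _ fun r hr => h _ ?_ k
    rw [Set.uIoc_of_le zero_le_one] at hr
    rw [abs_of_nonneg (mul_nonneg hr.1.le hb.le)]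
    nlinarith [hr.2]
  have hint : Integrable (fun r : ℝ => G (r * b)) := hG.integrable.comp_mul_right' hb.ne'
  have hline := hint.hasSum_intervalIntegral_comp_add_int
  rw [Measure.integral_comp_mul_right G b, abs_of_pos (inv_pos.2 hb), smul_eq_mul] at hline
  -- The unfolding identity sums over translations by `+k`, the periodization over `-k`.
  have hline' := (Equiv.neg ℤ).hasSum_iff.2 hline
  rw [div_eq_inv_mul]
  refine hswap.unique (hline'.congr_fun ?_)
  intro k
  simp only [Function.comp_apply, Equiv.neg_apply]
  refine intervalIntegral.integral_congr fun r _ => ?_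
  push_cast
  ring_nf

end ExpDecay

end Sketch

/-! ### Chebyshev-type comparison of weighted integrals. -/

namespace Sketch

/-- Two integrals against a strictly decreasing weight compare as the unweighted ones when the
quotient of the integrands is strictly decreasing. -/
theorem integral_div_lt_of_strictAnti {f g W : ℝ → ℝ} (hf : Continuous f) (hg : Continuous g)
    (hW : Continuous W) (hfi : Integrable f) (hgi : Integrable g)
    (hWf : Integrable fun w => W w * f w) (hWg : Integrable fun w => W w * g w)
    (hgpos : ∀ w, 0 < g w) (hratio : StrictAnti fun w => f w / g w) (hWanti : StrictAnti W)
    (hWpos : ∀ w, 0 < W w) :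
    (∫ w, f w) / (∫ w, g w) < (∫ w, W w * f w) / (∫ w, W w * g w) := by
  have hgI : 0 < ∫ w, g w :=
    integral_pos_of_integrable_nonneg_nonzero (x := 0) hg hgi (fun w => (hgpos w).le) (hgpos 0).ne'
  have hWgI : 0 < ∫ w, W w * g w :=
    integral_pos_of_integrable_nonneg_nonzero (x := 0) (hW.mul hg) hWg
      (fun w => (mul_pos (hWpos w) (hgpos w)).le) (mul_pos (hWpos 0) (hgpos 0)).ne'
  -- For this `c` the function `f - c g` has integral zero, so the claim becomes `0 < ∫ W (f - c
  -- g)`, and subtracting a constant from `W` changes nothing. Having integral zero, `f - c g` also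
  -- vanishes at some `w₀`.
  set c : ℝ := (∫ w, f w) / (∫ w, g w) with hc
  have hzero : ∫ w, (f w - c * g w) = 0 := by
    rw [integral_sub hfi (hgi.const_mul c), integral_const_mul, hc, div_mul_cancel₀ _ hgI.ne',
      sub_self]
  have hdc : Continuous fun w => f w - c * g w := hf.sub (hg.const_mul c)
  have hdi : Integrable fun w => f w - c * g w := hfi.sub (hgi.const_mul c)
  have hle : ∃ w, f w - c * g w ≤ 0 := by
    by_contra! hcon
    exact (integral_pos_of_integrable_nonneg_nonzero (x := 0) hdc hdi (fun w => (hcon w).le)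
      (hcon 0).ne').ne' hzero
  have hge : ∃ w, 0 ≤ f w - c * g w := by
    by_contra! hcon
    have hpos : 0 < ∫ w, -(f w - c * g w) :=
      integral_pos_of_integrable_nonneg_nonzero (x := 0) hdc.neg hdi.neg
        (fun w => neg_nonneg.2 (hcon w).le) (neg_ne_zero.2 (hcon 0).ne)
    rw [integral_neg, hzero, neg_zero] at hpos
    exact hpos.false
  obtain ⟨a, ha⟩ := hle
  obtain ⟨b, hb⟩ := hge
  obtain ⟨w₀, hw₀⟩ : ∃ w, f w - c * g w = 0 := mem_range_of_exists_le_of_exists_ge hdc ⟨a, ha⟩ ⟨b, hb⟩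
  have hc₀ : f w₀ / g w₀ = c := by
    rw [div_eq_iff (hgpos w₀).ne']; linarith
  -- Both `W` and `f / g` decrease strictly, so their differences from the values at `w₀` have the
  -- same sign.
  have hsign : ∀ w, w ≠ w₀ → 0 < (W w - W w₀) * (f w - c * g w) := by
    intro w hw
    have hfac : f w - c * g w = (f w / g w - f w₀ / g w₀) * g w := by
      rw [hc₀, sub_mul, div_mul_cancel₀ _ (hgpos w).ne']
    rw [hfac, ← mul_assoc]
    refine mul_pos ?_ (hgpos w)
    rcases lt_or_gt_of_ne hw with h | h
    · exact mul_pos (sub_pos.2 (hWanti h)) (sub_pos.2 (hratio h))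
    · exact mul_pos_of_neg_of_neg (sub_neg.2 (hWanti h)) (sub_neg.2 (hratio h))
  have hexp : ∀ w, (W w - W w₀) * (f w - c * g w)
      = (W w * f w - c * (W w * g w)) - W w₀ * (f w - c * g w) := fun w => by ring
  have hWd : Integrable fun w => W w * f w - c * (W w * g w) := hWf.sub (hWg.const_mul c)
  have hpos : 0 < ∫ w, (W w - W w₀) * (f w - c * g w) := by
    refine integral_pos_of_integrable_nonneg_nonzero (x := w₀ + 1)
      ((hW.sub continuous_const).mul hdc) ?_ (fun w => ?_) (hsign _ (by simp)).ne'
    · simp_rw [hexp]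
      exact hWd.sub (hdi.const_mul _)
    · rcases eq_or_ne w w₀ with rfl | hw
      · simp
      · exact (hsign w hw).le
  simp_rw [hexp] at hpos
  rw [integral_sub hWd (hdi.const_mul _), integral_const_mul, hzero,
    integral_sub hWf (hWg.const_mul c), integral_const_mul] at hpos
  rw [lt_div_iff₀ hWgI]
  linarith

/-! ### Monotonicity of `h(e^{-x}) / g(x)`. -/

/-- This is `a ≤ sinh a` at `a = -log √v`. -/
theorem neg_log_mul_sqrt_le {v : ℝ} (hv : 0 < v) (hv1 : v ≤ 1) : -Real.log v * √v ≤ 1 - v := by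
  have hs : 0 < √v := Real.sqrt_pos.2 hv
  have ha : 0 ≤ -Real.log √v := neg_nonneg.2 (Real.log_nonpos hs.le (Real.sqrt_le_one.2 hv1))
  have h := Real.self_le_sinh_iff.2 ha
  rw [Real.sinh_eq, neg_neg, Real.exp_neg, Real.exp_log hs, Real.log_sqrt hv.le] at h
  have h2 : -Real.log v ≤ (√v)⁻¹ - √v := by linarith
  calc -Real.log v * √v ≤ ((√v)⁻¹ - √v) * √v := mul_le_mul_of_nonneg_right h2 hs.le
    _ = 1 - v := by rw [sub_mul, inv_mul_cancel₀ hs.ne', Real.mul_self_sqrt hv.le]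

theorem one_sub_exp_neg_pos {x : ℝ} (hx : 0 < x) : 0 < 1 - Real.exp (-x) := by
  simpa using hx

theorem exp_sub_one_pos {x : ℝ} (hx : 0 < x) : 0 < Real.exp x - 1 := by
  have := Real.one_lt_exp_iff.2 hx
  linarith

theorem h_exp_neg (x : ℝ) :
    h (Real.exp (-x)) = x * Real.exp (-x) + Real.negMulLog (1 - Real.exp (-x)) := by
  simp only [h, Real.negMulLog, Real.log_exp]
  ring

theorem g_pos {x : ℝ} (hx : 0 < x) : 0 < g x :=
  div_pos (by positivity) (exp_sub_one_pos hx)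

theorem strictAntiOn_one_sub_exp_neg_div :
    StrictAntiOn (fun x : ℝ => (1 - Real.exp (-x)) / x) (Set.Ioi 0) := by
  refine strictAntiOn_of_deriv_neg (convex_Ioi 0) ?_ ?_
  · exact ContinuousOn.div (by fun_prop) continuousOn_id fun x hx => (Set.mem_Ioi.1 hx).ne'
  · intro x hx
    rw [interior_Ioi] at hx
    have hx : 0 < x := hx
    have hd : HasDerivAt (fun x : ℝ => (1 - Real.exp (-x)) / x)
        ((Real.exp (-x) * x - (1 - Real.exp (-x)) * 1) / x ^ 2) x := by
      refine HasDerivAt.div ?_ (hasDerivAt_id x) hx.ne'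
      exact (((hasDerivAt_neg x).exp).const_sub 1).congr_deriv (by ring)
    rw [hd.deriv]
    refine div_neg_of_neg_of_pos ?_ (by positivity)
    have h1 : x + 1 < Real.exp x := Real.add_one_lt_exp hx.ne'
    have h2 : Real.exp (-x) * Real.exp x = 1 := by rw [← Real.exp_add]; simp
    nlinarith [Real.exp_pos (-x)]

/-- Put `y = e^{-x}` and use `neg_log_mul_sqrt_le` twice: at `y` it gives `x - 1 + y ≤ x (1 - √y)`,
at `1 - y` it gives `-log (1 - y) √(1 - y) ≤ y`. The two are joined by `1 - √y ≤ √(1 - y)`. -/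
theorem neg_log_one_sub_exp_neg_mul_le {x : ℝ} (hx : 0 < x) :
    -Real.log (1 - Real.exp (-x)) * (x - 1 + Real.exp (-x)) ≤ x * Real.exp (-x) := by
  set y := Real.exp (-x) with hy
  have hy0 : 0 < y := Real.exp_pos _
  have hy1 : 0 < 1 - y := one_sub_exp_neg_pos hx
  have hlog : Real.log y = -x := by rw [hy, Real.log_exp]
  have h1 := neg_log_mul_sqrt_le hy0 (by linarith)
  have h2 := neg_log_mul_sqrt_le hy1 (by linarith)
  rw [hlog, neg_neg] at h1
  have hM : 0 ≤ -Real.log (1 - y) := neg_nonneg.2 (Real.log_nonpos hy1.le (by linarith))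
  set M := -Real.log (1 - y)
  have hs0 : 0 ≤ √y := Real.sqrt_nonneg y
  have hs1 : √y ≤ 1 := Real.sqrt_le_one.2 (by linarith)
  have hs : 1 - √y ≤ √(1 - y) := by
    refine Real.le_sqrt_of_sq_le ?_
    nlinarith [Real.sq_sqrt hy0.le]
  calc M * (x - 1 + y) ≤ M * (x * (1 - √y)) := mul_le_mul_of_nonneg_left (by linarith) hM
    _ = x * (M * (1 - √y)) := by ring
    _ ≤ x * (M * √(1 - y)) := by gcongr
    _ ≤ x * y := mul_le_mul_of_nonneg_left (by linarith) hx.le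

/-- With `M = -log (1 - e^{-x})`, the numerator of the derivative is `e^x (M (x - 1 + e^{-x}) - x
e^{-x})`, nonpositive by the previous inequality. -/
theorem antitoneOn_exp_sub_one_mul_neg_log_div :
    AntitoneOn (fun x : ℝ => (Real.exp x - 1) * -Real.log (1 - Real.exp (-x)) / x)
      (Set.Ioi 0) := by
  have hd : ∀ x : ℝ, 0 < x →
      HasDerivAt (fun x : ℝ => (Real.exp x - 1) * -Real.log (1 - Real.exp (-x)) / x)
        (((Real.exp x * -Real.log (1 - Real.exp (-x)) - 1) * x
          - (Real.exp x - 1) * -Real.log (1 - Real.exp (-x)) * 1) / x ^ 2) x := by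
    intro x hx
    refine HasDerivAt.div ?_ (hasDerivAt_id x) hx.ne'
    have h1 := (Real.hasDerivAt_exp x).sub_const 1
    have h2 := ((((hasDerivAt_neg x).exp).const_sub 1).log (one_sub_exp_neg_pos hx).ne').neg
    refine (h1.mul h2).congr_deriv ?_
    have h3 : Real.exp x - 1 = Real.exp x * (1 - Real.exp (-x)) := by
      rw [mul_sub, ← Real.exp_add]; simp
    have h4 : Real.exp x * Real.exp (-x) = 1 := by rw [← Real.exp_add]; simp
    have h5 := (one_sub_exp_neg_pos hx).ne'
    rw [h3]
    simp only [Pi.neg_apply]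
    field_simp
    linarith
  refine antitoneOn_of_deriv_nonpos (convex_Ioi 0)
    (fun x hx => (hd x hx).continuousAt.continuousWithinAt) ?_ ?_
  · rw [interior_Ioi]
    exact fun x hx => (hd x hx).differentiableAt.differentiableWithinAt
  · rw [interior_Ioi]
    intro x hx
    have hx : 0 < x := hx
    rw [(hd x hx).deriv]
    refine div_nonpos_of_nonpos_of_nonneg ?_ (by positivity)
    have h1 := neg_log_one_sub_exp_neg_mul_le hx
    have h4 : Real.exp x * Real.exp (-x) = 1 := by rw [← Real.exp_add]; simp
    have h5 := mul_le_mul_of_nonneg_left h1 (Real.exp_pos x).le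
    have h6 : Real.exp x * (x * Real.exp (-x)) = x := by
      rw [mul_left_comm, h4, mul_one]
    have h7 : Real.exp x * (-Real.log (1 - Real.exp (-x)) * (x - 1 + Real.exp (-x)))
        = -Real.log (1 - Real.exp (-x)) * (Real.exp x * x - Real.exp x + 1) := by
      linear_combination (-Real.log (1 - Real.exp (-x))) * h4
    rw [h6, h7] at h5
    linarith

theorem strictAntiOn_h_exp_neg_div_g :
    StrictAntiOn (fun x : ℝ => h (Real.exp (-x)) / g x) (Set.Ioi 0) := by
  -- The quotient splits into a positive strictly decreasing factor and a nonincreasing factor that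
  -- is at least 1.
  have hform : ∀ x : ℝ, 0 < x → h (Real.exp (-x)) / g x = (1 - Real.exp (-x)) / x *
      (1 + (Real.exp x - 1) * -Real.log (1 - Real.exp (-x)) / x) := by
    intro x hx
    have h4 : Real.exp (-x) = (Real.exp x)⁻¹ := Real.exp_neg x
    have h5 := (exp_sub_one_pos hx).ne'
    rw [h_exp_neg, g, Real.negMulLog]
    generalize Real.log (1 - Real.exp (-x)) = l
    rw [h4]
    have h6 := (Real.exp_pos x).ne'
    field_simp
  intro a ha b hb hab
  have ha0 : 0 < a := ha
  have hb0 : 0 < b := hb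
  simp only [hform a ha0, hform b hb0]
  have hnn : 0 ≤ (Real.exp b - 1) * -Real.log (1 - Real.exp (-b)) / b := by
    refine div_nonneg (mul_nonneg (exp_sub_one_pos hb0).le (neg_nonneg.2 ?_)) hb0.le
    exact Real.log_nonpos (one_sub_exp_neg_pos hb0).le (by linarith [Real.exp_pos (-b)])
  exact mul_lt_mul (strictAntiOn_one_sub_exp_neg_div ha hb hab)
    (add_le_add le_rfl (antitoneOn_exp_sub_one_mul_neg_log_div ha hb hab.le)) (by linarith)
    (div_nonneg (one_sub_exp_neg_pos ha0).le ha0.le)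

/-! ### Decay of the functions to be integrated. -/

theorem exp_neg_mul_pow_le {x : ℝ} (hx : 0 < x) (n : ℕ) :
    x ^ n * Real.exp (-x) ≤ (n + 1).factorial / x := by
  have h1 := Real.pow_div_factorial_le_exp x hx.le (n + 1)
  rw [div_le_iff₀ (by positivity)] at h1
  rw [Real.exp_neg, ← div_eq_mul_inv, div_le_div_iff₀ (Real.exp_pos x) hx, ← pow_succ]
  linarith

/-- These are the telescoping terms `K` of the chain rules: `n = 0` for entropy, `n = 1` for Fisher
information. The positive exponent gives decay as `s → -∞`. -/
theorem expDecay_pow_mul_exp_neg (n : ℕ) :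
    ExpDecay (fun s => Real.exp s ^ (n + 1) * Real.exp (-Real.exp s)) := by
  refine ExpDecay.of_exp_bound_linear (F := fun x => x ^ (n + 1) * Real.exp (-x)) (by fun_prop)
    (C := (n + 1 + 1).factorial) (by positivity) (fun x hx hx1 => ?_) (fun x hx1 => ?_)
  · rw [abs_of_nonneg (by positivity)]
    calc x ^ (n + 1) * Real.exp (-x) ≤ x * 1 := by
          refine mul_le_mul ?_ (Real.exp_le_one_iff.2 (by linarith)) (Real.exp_pos _).le hx.le
          simpa using pow_le_pow_of_le_one hx.le hx1 (Nat.le_add_left 1 n)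
      _ ≤ (n + 1 + 1).factorial * x := by
          have : (1 : ℝ) ≤ (n + 1 + 1).factorial := by exact_mod_cast Nat.factorial_pos _
          nlinarith
  · rw [abs_of_nonneg (by positivity)]
    exact exp_neg_mul_pow_le (by linarith) (n + 1)

theorem expDecay_g : ExpDecay (fun w => g (Real.exp w)) := by
  refine ExpDecay.of_exp_bound_linear (F := g) ?_ (C := 6) (by norm_num)
    (fun x hx hx1 => ?_) (fun x hx1 => ?_)
  · unfold g
    exact Continuous.div (by fun_prop) (by fun_prop)
      fun w => (exp_sub_one_pos (Real.exp_pos w)).ne'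
  · rw [abs_of_pos (g_pos hx), g, div_le_iff₀ (exp_sub_one_pos hx)]
    nlinarith [Real.add_one_le_exp x]
  · have hx : 0 < x := by linarith
    rw [abs_of_pos (g_pos hx), g, div_le_div_iff₀ (exp_sub_one_pos hx) hx]
    -- The cubic Taylor term gives `x³ ≤ 6 (e^x - 1)`, hence the constant 6.
    have := Real.sum_le_exp_of_nonneg hx.le 4
    simp only [Finset.sum_range_succ, Finset.sum_range_zero] at this
    norm_num [Nat.factorial] at this
    nlinarith [sq_nonneg x]

/-- Near `x = 0` this behaves like `-x log x`, which is `O(√x)` but not `O(x)`; hence the rate `1/2`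
in `ExpDecay`. -/
theorem expDecay_negMulLog_one_sub_exp_neg :
    ExpDecay (fun w => Real.negMulLog (1 - Real.exp (-Real.exp w))) := by
  have hnn : ∀ x : ℝ, 0 < x → 0 ≤ Real.negMulLog (1 - Real.exp (-x)) := fun x hx =>
    Real.negMulLog_nonneg (one_sub_exp_neg_pos hx).le (by linarith [Real.exp_pos (-x)])
  have hle : ∀ x : ℝ, 0 < x → Real.negMulLog (1 - Real.exp (-x))
      ≤ √(1 - Real.exp (-x)) * Real.exp (-x) := by
    intro x hx
    have hu := one_sub_exp_neg_pos hx
    have h1 := neg_log_mul_sqrt_le hu (by linarith [Real.exp_pos (-x)])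
    calc Real.negMulLog (1 - Real.exp (-x))
        = √(1 - Real.exp (-x)) * (-Real.log (1 - Real.exp (-x)) * √(1 - Real.exp (-x))) := by
          rw [Real.negMulLog]
          linear_combination Real.log (1 - Real.exp (-x)) * Real.mul_self_sqrt hu.le
      _ ≤ _ := mul_le_mul_of_nonneg_left (by linarith) (Real.sqrt_nonneg _)
  refine ExpDecay.of_exp_bound (F := fun x => Real.negMulLog (1 - Real.exp (-x)))
    (Real.continuous_negMulLog.comp (by fun_prop)) (C := 1) (fun x hx hx1 => ?_) (fun x hx1 => ?_)
  · rw [abs_of_nonneg (hnn x hx), one_mul]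
    refine (hle x hx).trans ?_
    calc √(1 - Real.exp (-x)) * Real.exp (-x) ≤ √x * 1 := by
          refine mul_le_mul (Real.sqrt_le_sqrt ?_) (Real.exp_le_one_iff.2 (by linarith))
            (Real.exp_pos _).le (Real.sqrt_nonneg _)
          linarith [Real.add_one_le_exp (-x)]
      _ = √x := mul_one _
  · have hx : 0 < x := by linarith
    rw [abs_of_nonneg (hnn x hx), one_mul]
    refine (hle x hx).trans ?_
    calc √(1 - Real.exp (-x)) * Real.exp (-x) ≤ 1 * x⁻¹ := by
          refine mul_le_mul (Real.sqrt_le_one.2 (by linarith [Real.exp_pos (-x)])) ?_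
            (Real.exp_pos _).le zero_le_one
          rw [Real.exp_neg]
          exact inv_anti₀ hx (by linarith [Real.add_one_le_exp x])
      _ ≤ (√x)⁻¹ := by
          rw [one_mul]
          exact inv_anti₀ (Real.sqrt_pos.2 hx) ((Real.sqrt_le_self_iff.2 (Or.inr hx1)))

theorem expDecay_h : ExpDecay (fun w => h (Real.exp (-Real.exp w))) := by
  simp_rw [h_exp_neg]
  simpa using (expDecay_pow_mul_exp_neg 0).add expDecay_negMulLog_one_sub_exp_neg

end Sketch

/-! ### The weight: probability that the higher columns are empty. -/

namespace Sketch

variable {q t : ℝ}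

/-- The probability that all columns above the current one of a base-`q` sketch are empty,
as a function of the logarithm of the rate of the current column. -/
noncomputable def emptyAboveProb (q w : ℝ) : ℝ :=
  Real.exp (-(Real.exp w / (q - 1)))

theorem continuous_emptyAboveProb (q : ℝ) : Continuous (emptyAboveProb q) := by
  unfold emptyAboveProb
  fun_prop

theorem emptyAboveProb_pos (q w : ℝ) : 0 < emptyAboveProb q w :=
  Real.exp_pos _

theorem abs_emptyAboveProb_le_one (hq : 1 < q) (w : ℝ) : |emptyAboveProb q w| ≤ 1 := by
  rw [abs_of_pos (emptyAboveProb_pos q w)]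
  refine Real.exp_le_one_iff.2 (neg_nonpos.2 (div_nonneg (Real.exp_pos w).le ?_))
  linarith

theorem strictAnti_emptyAboveProb (hq : 1 < q) : StrictAnti (emptyAboveProb q) := by
  intro a b hab
  refine Real.exp_lt_exp.2 (neg_lt_neg ?_)
  exact div_lt_div_of_pos_right (Real.exp_lt_exp.2 hab) (by linarith)

theorem tendsto_emptyAboveProb (w : ℝ) :
    Tendsto (fun q => emptyAboveProb q w) atTop (𝓝 1) := by
  have h1 : Tendsto (fun q : ℝ => Real.exp w / (q - 1)) atTop (𝓝 0) :=
    tendsto_const_nhds.div_atTop (tendsto_atTop_add_const_right _ _ tendsto_id)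
  simpa [emptyAboveProb, Function.comp_def] using (Real.continuous_exp.tendsto _).comp h1.neg

theorem emptyAboveProb_shift (hq : 1 < q) (r : ℝ) :
    emptyAboveProb q (r + Real.log (q - 1)) = Real.exp (-Real.exp r) := by
  have h1 : 0 < q - 1 := by linarith
  rw [emptyAboveProb, Real.exp_add, Real.exp_log h1, mul_div_cancel_right₀ _ h1.ne']

theorem ExpDecay.emptyAboveProb_mul {G : ℝ → ℝ} (hG : ExpDecay G) (hq : 1 < q) :
    ExpDecay (fun w => emptyAboveProb q w * G w) :=
  hG.mul_of_abs_le (continuous_emptyAboveProb q) (abs_emptyAboveProb_le_one hq)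

theorem ExpDecay.tendsto_integral_emptyAboveProb_mul {G : ℝ → ℝ} (hG : ExpDecay G) :
    Tendsto (fun q => ∫ w, emptyAboveProb q w * G w) atTop (𝓝 (∫ w, G w)) := by
  refine tendsto_integral_filter_of_dominated_convergence (fun w => |G w|) ?_ ?_
    hG.integrable.abs (ae_of_all _ fun w => ?_)
  · exact Eventually.of_forall fun q =>
      ((continuous_emptyAboveProb q).mul hG.continuous).aestronglyMeasurable
  · filter_upwards [eventually_gt_atTop 1] with q hq
    refine ae_of_all _ fun w => ?_
    rw [Real.norm_eq_abs, abs_mul]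
    exact mul_le_of_le_one_left (abs_nonneg _) (abs_emptyAboveProb_le_one hq w)
  · simpa using (tendsto_emptyAboveProb w).mul_const (G w)

/-! ### Chain rules -/

theorem exp_neg_sub_exp_neg_mul (q x : ℝ) :
    Real.exp (-x) - Real.exp (-(x * q))
      = Real.exp (-x) * (1 - Real.exp (-(x * (q - 1)))) := by
  rw [mul_sub, ← Real.exp_add, mul_one]
  ring_nf

theorem exp_neg_sub_exp_neg_mul_pos (hq : 1 < q) {x : ℝ} (hx : 0 < x) :
    0 < Real.exp (-x) - Real.exp (-(x * q)) := by
  rw [exp_neg_sub_exp_neg_mul]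
  exact mul_pos (Real.exp_pos _) (one_sub_exp_neg_pos (mul_pos hx (by linarith)))

theorem exp_add_log_sub_one (hq : 1 < q) (r : ℝ) :
    Real.exp (r + Real.log (q - 1)) = Real.exp r * (q - 1) := by
  rw [Real.exp_add, Real.exp_log (by linarith)]

theorem exp_add_log (hq : 1 < q) (r : ℝ) : Real.exp (r + Real.log q) = Real.exp r * q := by
  rw [Real.exp_add, Real.exp_log (by linarith)]

/-- Chain rule for entropy: for `p = e^{-x} u` with `u = 1 - e^{-x(q-1)}`, `-p ln p = x p - e^{-x} u
ln u`. Completing the last term to `e^{-x} h(e^{-x(q-1)})` leaves `x e^{-x} - xq e^{-xq}`. -/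
theorem phiIntegrand_eq (hq : 1 < q) (r : ℝ) :
    phiIntegrand q r = (Real.log 2)⁻¹ *
      (emptyAboveProb q (r + Real.log (q - 1)) *
          h (Real.exp (-Real.exp (r + Real.log (q - 1))))
        + (Real.exp r ^ (0 + 1) * Real.exp (-Real.exp r)
          - Real.exp (r + Real.log q) ^ (0 + 1) * Real.exp (-Real.exp (r + Real.log q)))) := by
  rw [emptyAboveProb_shift hq, exp_add_log_sub_one hq, exp_add_log hq, phiIntegrand, h_exp_neg,
    Real.logb, exp_neg_sub_exp_neg_mul]
  have hx := Real.exp_pos r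
  generalize Real.exp r = x at hx
  have hu := one_sub_exp_neg_pos (mul_pos hx (sub_pos.2 hq))
  have hz : Real.exp (-(x * q)) = Real.exp (-x) * Real.exp (-(x * (q - 1))) := by
    rw [← Real.exp_add]; ring_nf
  rw [Real.log_mul (Real.exp_pos _).ne' hu.ne', Real.log_exp, Real.negMulLog, hz]
  ring

/-- The Fisher counterpart: expanding the square leaves `x² e^{-x} - (xq)² e^{-xq}` beside the
weighted `g(x(q-1))`. -/
theorem rhoIntegrand_eq (hq : 1 < q) (r : ℝ) :
    rhoIntegrand q r = emptyAboveProb q (r + Real.log (q - 1)) *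
          g (Real.exp (r + Real.log (q - 1)))
        + (Real.exp r ^ (1 + 1) * Real.exp (-Real.exp r)
          - Real.exp (r + Real.log q) ^ (1 + 1) * Real.exp (-Real.exp (r + Real.log q))) := by
  rw [emptyAboveProb_shift hq, exp_add_log_sub_one hq, exp_add_log hq, rhoIntegrand, g,
    exp_neg_sub_exp_neg_mul]
  have hx := Real.exp_pos r
  generalize Real.exp r = x at hx
  have hd := (exp_sub_one_pos (mul_pos hx (sub_pos.2 hq))).ne'
  have hz : Real.exp (-(x * q)) = Real.exp (-x) * (Real.exp (x * (q - 1)))⁻¹ := by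
    rw [← Real.exp_neg, ← Real.exp_add]; ring_nf
  rw [hz, Real.exp_neg (x * (q - 1))]
  have he := (Real.exp_pos (x * (q - 1))).ne'
  have hy := (Real.exp_pos (-x)).ne'
  generalize Real.exp (x * (q - 1)) = e at *
  generalize Real.exp (-x) = y at *
  field_simp
  ring

theorem expDecay_phiIntegrand (hq : 1 < q) : ExpDecay (phiIntegrand q) := by
  have hk := expDecay_pow_mul_exp_neg 0
  have := (((expDecay_h.emptyAboveProb_mul hq).comp_add_right (Real.log (q - 1))).add
    (hk.sub (hk.comp_add_right (Real.log q)))).const_mul (Real.log 2)⁻¹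
  rwa [← funext (phiIntegrand_eq hq)] at this

theorem expDecay_rhoIntegrand (hq : 1 < q) : ExpDecay (rhoIntegrand q) := by
  have hk := expDecay_pow_mul_exp_neg 1
  have := ((expDecay_g.emptyAboveProb_mul hq).comp_add_right (Real.log (q - 1))).add
    (hk.sub (hk.comp_add_right (Real.log q)))
  rwa [← funext (rhoIntegrand_eq hq)] at this

/-- Translation invariance removes the shift of `G` and cancels the two integrals of `K`. -/
theorem ExpDecay.integral_shift_add_sub {G K : ℝ → ℝ} (hG : ExpDecay G) (hK : ExpDecay K)
    (a b : ℝ) : ∫ r, (G (r + a) + (K r - K (r + b))) = ∫ r, G r := by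
  rw [integral_add (hG.comp_add_right a).integrable (hK.sub (hK.comp_add_right b)).integrable,
    integral_sub hK.integrable (hK.comp_add_right b).integrable,
    integral_add_right_eq_self G, integral_add_right_eq_self K, sub_self, add_zero]

theorem phi_eq (hq : 1 < q) :
    phi q = (Real.log 2)⁻¹ * ∫ w, emptyAboveProb q w * h (Real.exp (-Real.exp w)) := by
  simp_rw [phi, phiIntegrand_eq hq]
  rw [integral_const_mul, (expDecay_h.emptyAboveProb_mul hq).integral_shift_add_sub
    (expDecay_pow_mul_exp_neg 0) (Real.log (q - 1)) (Real.log q)]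

theorem rho_eq (hq : 1 < q) : rho q = ∫ w, emptyAboveProb q w * g (Real.exp w) := by
  simp_rw [rho, rhoIntegrand_eq hq]
  exact (expDecay_g.emptyAboveProb_mul hq).integral_shift_add_sub
    (expDecay_pow_mul_exp_neg 1) (Real.log (q - 1)) (Real.log q)

theorem I₀_pos : 0 < I₀ :=
  integral_pos_of_integrable_nonneg_nonzero (x := 0) expDecay_g.continuous expDecay_g.integrable
    (fun w => (g_pos (Real.exp_pos w)).le) (g_pos (Real.exp_pos 0)).ne'

theorem rho_pos (hq : 1 < q) : 0 < rho q := by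
  rw [rho_eq hq]
  have hd := expDecay_g.emptyAboveProb_mul hq
  have hpos : ∀ w, 0 < emptyAboveProb q w * g (Real.exp w) := fun w =>
    mul_pos (emptyAboveProb_pos q w) (g_pos (Real.exp_pos w))
  exact integral_pos_of_integrable_nonneg_nonzero (x := 0) hd.continuous hd.integrable
    (fun w => (hpos w).le) (hpos 0).ne'

theorem H₀_div_I₀_lt (hq : 1 < q) : H₀ / I₀ < phi q / rho q := by
  have hlog : (0 : ℝ) < (Real.log 2)⁻¹ := inv_pos.2 (Real.log_pos one_lt_two)
  rw [phi_eq hq, rho_eq hq, H₀, I₀, one_div, mul_div_assoc, mul_div_assoc]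
  refine mul_lt_mul_of_pos_left ?_ hlog
  refine integral_div_lt_of_strictAnti expDecay_h.continuous expDecay_g.continuous
    (continuous_emptyAboveProb q) expDecay_h.integrable expDecay_g.integrable
    (expDecay_h.emptyAboveProb_mul hq).integrable (expDecay_g.emptyAboveProb_mul hq).integrable
    (fun w => g_pos (Real.exp_pos w)) ?_ (strictAnti_emptyAboveProb hq) (emptyAboveProb_pos q)
  exact fun a b hab => strictAntiOn_h_exp_neg_div_g (Set.mem_Ioi.2 (Real.exp_pos a))
    (Set.mem_Ioi.2 (Real.exp_pos b)) (Real.exp_lt_exp.2 hab)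

theorem tendsto_phi_div_rho : Tendsto (fun q => phi q / rho q) atTop (𝓝 (H₀ / I₀)) := by
  have hlim := (expDecay_h.tendsto_integral_emptyAboveProb_mul.const_mul (Real.log 2)⁻¹).div
    expDecay_g.tendsto_integral_emptyAboveProb_mul I₀_pos.ne'
  rw [← one_div] at hlim
  refine hlim.congr' ?_
  filter_upwards [eventually_gt_atTop 1] with q hq
  rw [phi_eq hq, rho_eq hq, one_div]
  rfl

/-! ### The sketch -/

theorem exp_log_sub_int_mul_log (hq : 1 < q) (ht : 0 < t) (k : ℤ) :
    Real.exp (Real.log t - k * Real.log q) = t / q ^ k := by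
  rw [Real.exp_sub, Real.exp_log ht, ← Real.log_zpow,
    Real.exp_log (zpow_pos (by linarith) k)]

theorem div_zpow_sub_one (hq : 1 < q) (t : ℝ) (k : ℤ) : t / q ^ (k - 1) = t / q ^ k * q := by
  have hq0 : q ≠ 0 := by linarith
  rw [zpow_sub_one₀ hq0]
  field_simp

theorem qLL_eq (hq : 1 < q) (t : ℝ) (k : ℤ) :
    qLL q t k = Real.exp (-(t / q ^ k)) - Real.exp (-(t / q ^ k * q)) := by
  rw [qLL, div_zpow_sub_one hq]

theorem qLL_pos (hq : 1 < q) (ht : 0 < t) (k : ℤ) : 0 < qLL q t k := by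
  rw [qLL_eq hq]
  exact exp_neg_sub_exp_neg_mul_pos hq (div_pos ht (zpow_pos (by linarith) k))

theorem qLL_mul_base (hq : 1 < q) (t : ℝ) (k : ℤ) : qLL q (q * t) k = qLL q t (k - 1) := by
  rw [qLL_eq hq, qLL_eq hq, div_zpow_sub_one hq, mul_comm q t, mul_div_right_comm]

/-- The sum telescopes on each half-line. The states `k ≥ 0` contribute `1 - e^{-tq}` and the states
`k < 0` contribute `e^{-tq}`. -/
theorem hasSum_qLL (hq : 1 < q) (ht : 0 < t) : HasSum (qLL q t) 1 := by
  have hq0 : 0 < q := by linarith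
  have hpow : Tendsto (fun n : ℕ => q ^ n) atTop atTop := tendsto_pow_atTop_atTop_of_one_lt hq
  have htop : Tendsto (fun n : ℕ => Real.exp (-(t / q ^ ((n : ℤ) - 1)))) atTop (𝓝 1) := by
    have h1 : Tendsto (fun n : ℕ => t / q ^ n * q) atTop (𝓝 (0 * q)) :=
      (tendsto_const_nhds.div_atTop hpow).mul_const q
    have h2 := (Real.continuous_exp.tendsto _).comp h1.neg
    simp only [zero_mul, neg_zero, Real.exp_zero] at h2
    refine h2.congr fun n => ?_
    simp only [Function.comp_apply, div_zpow_sub_one hq, zpow_natCast]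
  have hbot : Tendsto (fun n : ℕ => Real.exp (-(t / q ^ (-((n : ℤ) + 1))))) atTop (𝓝 0) := by
    have h1 : Tendsto (fun n : ℕ => t * q ^ (n + 1)) atTop atTop :=
      ((tendsto_add_atTop_iff_nat 1).2 hpow).const_mul_atTop ht
    refine (Real.tendsto_exp_neg_atTop_nhds_zero.comp h1).congr fun n => ?_
    simp only [Function.comp_apply]
    rw [zpow_neg, div_inv_eq_mul]
    norm_cast
  have hpos : HasSum (fun n : ℕ => qLL q t n) (1 - Real.exp (-(t / q ^ (-1 : ℤ)))) := by
    rw [hasSum_iff_tendsto_nat_of_nonneg fun n => (qLL_pos hq ht _).le]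
    refine (htop.sub_const _).congr fun N => ?_
    have := Finset.sum_range_sub (fun n : ℕ => Real.exp (-(t / q ^ ((n : ℤ) - 1)))) N
    simp only [Nat.cast_zero, zero_sub] at this
    rw [← this]
    refine Finset.sum_congr rfl fun n _ => ?_
    simp [qLL]
  have hneg : HasSum (fun n : ℕ => qLL q t (-(n + 1))) (Real.exp (-(t / q ^ (-1 : ℤ))) - 0) := by
    rw [hasSum_iff_tendsto_nat_of_nonneg fun n => (qLL_pos hq ht _).le]
    refine (hbot.const_sub _).congr fun N => ?_
    have := Finset.sum_range_sub' (fun n : ℕ => Real.exp (-(t / q ^ (-((n : ℤ) + 1))))) N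
    simp only [Nat.cast_zero, zero_add] at this
    rw [← this]
    refine Finset.sum_congr rfl fun n _ => ?_
    rw [qLL]
    push_cast
    ring_nf
  simpa using hpos.of_nat_of_neg_add_one hneg

theorem isInducedFamily_qLL (hq : 1 < q) : IsInducedFamily (qLL q) :=
  ⟨fun _ ht k => (qLL_pos hq ht k).le, fun _ ht => hasSum_qLL hq ht⟩

theorem entropyTerm_qLL (hq : 1 < q) (ht : 0 < t) (k : ℤ) :
    entropyTerm (qLL q t) k = phiIntegrand q (Real.log t - k * Real.log q) := by
  rw [entropyTerm, phiIntegrand, exp_log_sub_int_mul_log hq ht, qLL_eq hq]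
  ring

theorem hasDerivAt_qLL (hq : 1 < q) (t : ℝ) (k : ℤ) :
    HasDerivAt (fun s => qLL q s k)
      (-(1 / q ^ k * Real.exp (-(t / q ^ k))) + 1 / q ^ k * q * Real.exp (-(t / q ^ k * q))) t := by
  simp_rw [qLL_eq hq]
  have h1 : HasDerivAt (fun s : ℝ => s / q ^ k) (1 / q ^ k) t := (hasDerivAt_id t).div_const _
  exact (h1.neg.exp.sub (h1.mul_const q).neg.exp).congr_deriv (by simp only [Pi.neg_apply]; ring)

/-- The factor `t⁻²` comes from differentiating in `t` rather than `log t`; the normalization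
`q^{2r}` at `t = q^r` cancels it. -/
theorem fisherTerm_qLL (hq : 1 < q) (ht : 0 < t) (k : ℤ) :
    fisherTerm (qLL q) t k = (t ^ 2)⁻¹ * rhoIntegrand q (Real.log t - k * Real.log q) := by
  have hP := (qLL_pos hq ht k).ne'
  rw [fisherTerm, (hasDerivAt_qLL hq t k).deriv, rhoIntegrand, exp_log_sub_int_mul_log hq ht,
    ← qLL_eq hq]
  generalize qLL q t k = P at hP
  have hqk := (zpow_pos (by linarith : 0 < q) k).ne'
  field_simp

theorem summable_entropyTerm_qLL (hq : 1 < q) (ht : 0 < t) :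
    Summable (entropyTerm (qLL q t)) := by
  rw [funext (entropyTerm_qLL hq ht)]
  exact (expDecay_phiIntegrand hq).summable_shift (Real.log_pos hq) _

theorem summable_fisherTerm_qLL (hq : 1 < q) (ht : 0 < t) :
    Summable (fisherTerm (qLL q) t) := by
  rw [funext (fisherTerm_qLL hq ht)]
  exact ((expDecay_rhoIntegrand hq).summable_shift (Real.log_pos hq) _).mul_left _

theorem fisherTerm_qLL_mul_base (hq : 1 < q) (ht : 0 < t) (k : ℤ) :
    q ^ 2 * fisherTerm (qLL q) (q * t) k = fisherTerm (qLL q) t (k - 1) := by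
  have hq0 : 0 < q := by linarith
  rw [fisherTerm_qLL hq (mul_pos hq0 ht), fisherTerm_qLL hq ht, Real.log_mul hq0.ne' ht.ne']
  have : Real.log q + Real.log t - k * Real.log q
      = Real.log t - ((k - 1 : ℤ) : ℝ) * Real.log q := by push_cast; ring
  rw [this]
  field_simp

/-- Multiplying the cardinality by `q` shifts the state by one, so both sums are merely reindexed.
-/
theorem weaklyScaleInvariant_qLL (hq : 1 < q) : WeaklyScaleInvariant (qLL q) q := by
  intro t ht
  constructor
  · rw [entropy, entropy, ← (Equiv.subRight (1 : ℤ)).tsum_eq (entropyTerm (qLL q t))]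
    refine tsum_congr fun k => ?_
    simp only [entropyTerm, Equiv.subRight_apply, qLL_mul_base hq]
  · rw [fisherInfo, fisherInfo, ← (Equiv.subRight (1 : ℤ)).tsum_eq (fisherTerm (qLL q) t),
      ← tsum_mul_left]
    refine tsum_congr fun k => ?_
    rw [Equiv.subRight_apply, fisherTerm_qLL_mul_base hq ht]

theorem entropy_qLL_rpow (hq : 1 < q) (r : ℝ) :
    entropy (qLL q (q ^ r)) = ∑' k : ℤ, phiIntegrand q (r * Real.log q - k * Real.log q) := by
  have hq0 : 0 < q := by linarith
  simp_rw [entropy, entropyTerm_qLL hq (Real.rpow_pos_of_pos hq0 r), Real.log_rpow hq0]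

theorem rpow_mul_fisherInfo_qLL_rpow (hq : 1 < q) (r : ℝ) :
    q ^ (2 * r) * fisherInfo (qLL q) (q ^ r)
      = ∑' k : ℤ, rhoIntegrand q (r * Real.log q - k * Real.log q) := by
  have hq0 : 0 < q := by linarith
  have hr := Real.rpow_pos_of_pos hq0 r
  simp_rw [fisherInfo, fisherTerm_qLL hq hr, Real.log_rpow hq0]
  rw [tsum_mul_left, ← mul_assoc, mul_comm 2 r, Real.rpow_mul hq0.le, Real.rpow_two,
    mul_inv_cancel₀ (pow_pos hr 2).ne', one_mul]

theorem avgEntropy_qLL (hq : 1 < q) : avgEntropy (qLL q) q = phi q / Real.log q := by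
  simp_rw [avgEntropy, entropy_qLL_rpow hq]
  exact (expDecay_phiIntegrand hq).integral_tsum_shift (Real.log_pos hq)

theorem avgInfo_qLL (hq : 1 < q) : avgInfo (qLL q) q = rho q / Real.log q := by
  simp_rw [avgInfo, rpow_mul_fisherInfo_qLL_rpow hq]
  exact (expDecay_rhoIntegrand hq).integral_tsum_shift (Real.log_pos hq)

theorem fish_qLL (hq : 1 < q) : fish (qLL q) q = phi q / rho q := by
  rw [fish, avgEntropy_qLL hq, avgInfo_qLL hq, div_div_div_cancel_right₀ (Real.log_pos hq).ne']

theorem ExpDecay.intervalIntegrable_tsum_shift {G : ℝ → ℝ} (hG : ExpDecay G) {b : ℝ}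
    (hb : 0 < b) :
    IntervalIntegrable (fun r : ℝ => ∑' k : ℤ, G (r * b - k * b)) volume 0 1 :=
  ContinuousOn.intervalIntegrable_of_Icc zero_le_one (hG.continuousOn_tsum_shift hb)

end Sketch

theorem theorem4p6 :
    -- the integrals that define `H₀` and `I₀` converge, and `H₀ / I₀` is a genuine quotient
    (Integrable (fun w : ℝ => Sketch.h (Real.exp (-Real.exp w))) ∧
      Integrable (fun w : ℝ => Sketch.g (Real.exp w)) ∧
      0 < Sketch.I₀) ∧
    (∀ q : ℝ, 1 < q →
      -- the Fish number of `q`-LL is well defined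
      Sketch.IsInducedFamily (Sketch.qLL q) ∧
      (∀ t : ℝ, 0 < t → Summable (Sketch.entropyTerm (Sketch.qLL q t))) ∧
      (∀ t : ℝ, 0 < t → Summable (Sketch.fisherTerm (Sketch.qLL q) t)) ∧
      Sketch.WeaklyScaleInvariant (Sketch.qLL q) q ∧
      IntervalIntegrable (fun r : ℝ => Sketch.entropy (Sketch.qLL q (q ^ r))) volume 0 1 ∧
      IntervalIntegrable
        (fun r : ℝ => q ^ (2 * r) * Sketch.fisherInfo (Sketch.qLL q) (q ^ r)) volume 0 1 ∧
      0 < Sketch.avgInfo (Sketch.qLL q) q ∧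
      -- it equals `φ(q) / ρ(q)`
      Integrable (Sketch.phiIntegrand q) ∧
      Integrable (Sketch.rhoIntegrand q) ∧
      0 < Sketch.rho q ∧
      Sketch.fish (Sketch.qLL q) q = Sketch.phi q / Sketch.rho q ∧
      -- and it is strictly larger than `H₀ / I₀`
      Sketch.fish (Sketch.qLL q) q > Sketch.H₀ / Sketch.I₀) ∧
    Tendsto (fun q : ℝ => Sketch.fish (Sketch.qLL q) q) atTop
      (𝓝 (Sketch.H₀ / Sketch.I₀)) := by
  refine ⟨⟨Sketch.expDecay_h.integrable, Sketch.expDecay_g.integrable, Sketch.I₀_pos⟩,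
    fun q hq => ?_, ?_⟩
  · have hlog := Real.log_pos hq
    refine ⟨Sketch.isInducedFamily_qLL hq, fun t ht => Sketch.summable_entropyTerm_qLL hq ht,
      fun t ht => Sketch.summable_fisherTerm_qLL hq ht, Sketch.weaklyScaleInvariant_qLL hq,
      ?_, ?_, ?_, (Sketch.expDecay_phiIntegrand hq).integrable,
      (Sketch.expDecay_rhoIntegrand hq).integrable, Sketch.rho_pos hq, Sketch.fish_qLL hq, ?_⟩
    · simp_rw [Sketch.entropy_qLL_rpow hq]
      exact (Sketch.expDecay_phiIntegrand hq).intervalIntegrable_tsum_shift hlog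
    · simp_rw [Sketch.rpow_mul_fisherInfo_qLL_rpow hq]
      exact (Sketch.expDecay_rhoIntegrand hq).intervalIntegrable_tsum_shift hlog
    · rw [Sketch.avgInfo_qLL hq]
      exact div_pos (Sketch.rho_pos hq) hlog
    · rw [Sketch.fish_qLL hq]
      exact Sketch.H₀_div_I₀_lt hq
  -- The formula for Fish is available only for `q > 1`, which holds eventually.
  · refine Sketch.tendsto_phi_div_rho.congr' ?_
    filter_upwards [eventually_gt_atTop 1] with q hq
    rw [Sketch.fish_qLL hq]
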